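/- **Setting.** Let $\mathcal U$ be the space of open subsets of $(0,1)$, with the Hausdorff distance between complements in $[0,1]$ and its Borel $\sigma$-algebra; the fragments of $u\in\mathcal U$ are its connected components $u_1,u_2,\dots$ (finitely or countably many open intervals), and $|\cdot|$ is Lebesgue measure. Let $(q_t)_{t>0}$ be probability measures on $\mathcal U$, and for $u\in\mathcal U$ let $q^u_t$ be the law of $\bigcup_i X_i$, where the $X_i$ are independent and $X_i$ is distributed as the image of a $q_t$-distributed set under the increasing affine map of $(0,1)$ onto $u_i$. A conservative homogeneous interval fragmentation started from $u$ is a $\mathcal U$-valued process $U=(U(t))_{t\ge0}$ which almost surely satisfies $U(0)=u$, $U(s)\subseteq U(t)$ for $s>t$, and $|U(t)|=|u|$ for all $t$, which is continuous in probability, and which satisfies $P(U(s)\in A\mid U(r),\,r\le t)=q^{U(t)}_{s-t}(A)$ for all $s>t\ge0$ and Borel $A\subseteq\mathcal U$. Write $\mathbf P_u,\mathbf E_u$ for its law and expectation, and $\mathbf P,\mathbf E$ when $u=(0,1)$; the family $(q_t)$ is fixed. For $x\in U(t)$ let $I^x(t)$ be the length of the fragment of $U(t)$ containing $x$, and $\xi^x_t=-\log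 I^x(t)$. Under $\mathbf P$, let $\upsilon$ be uniform on $(0,1)$ and independent of $U$, put $\xi_t=\xi^\upsilon_t$, $\Phi(p)=-\log\mathbf E[e^{-p\xi_1}]$ and $\underline p=\inf\{p\ge-1:\mathbf E[e^{-p\xi_1}]<\infty\}\in[-1,0]$. Let $\overline p\in(\underline p,\infty)$ satisfy $\Phi(\overline p)/(1+\overline p)=\Phi'(\overline p)$, put $c=\Phi'(\overline p)$, $\zeta^x_t=\xi^x_t-ct$ and $\zeta_t=\xi_t-ct$. Fix $t\ge0$ and let $\mathbf Q$ be a measure with $$\frac{d\mathbf Q}{d\mathbf P}=\exp\big(\Phi(\overline p)t-\overline p\,\xi_t\big)\qquad\text{on the }\sigma\text{-algebra generated by }\upsilon\text{ and }(U(s):s\le t).$$ **Many-to-one formula.** For every $u\in\mathcal U$ and every $F:\mathbb R^{[0,t]}\to[0,\infty]$ that is measurable with respect to the $\sigma$-algebra generated by the coordinates, $$\mathbf E_u\sum_{[x]_t}F(\zeta^x_s:s\le t)=\sum_i\mathbf Q\Big(e^{(\overline p+1)\zeta_t}\,F(\zeta_s-\log|u_i|:s\le t)\Big),$$ where the left-hand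 sum runs over the distinct fragments of $U(t)$, $x$ being any point of the fragment, and the right-hand sum over the fragments of $u$. In particular $$\mathbf E\sum_{[x]_t}F(\zeta^x_s:s\le t)=\mathbf Q\Big(e^{(\overline p+1)\zeta_t}\,F(\zeta_s:s\le t)\Big).$$ -/

import Mathlib

open MeasureTheory ProbabilityTheory Set Filter Topology
open scoped NNReal ENNReal

noncomputable section

namespace Fragmentation

/-- The state space: open subsets of the interval `(0,1)`. -/
def Config : Type := {u : Set ℝ // IsOpen u ∧ u ⊆ Ioo (0 : ℝ) 1}

namespace Config

instance : CoeOut Config (Set ℝ) := ⟨fun u => u.1⟩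

theorem isOpen (u : Config) : IsOpen (u : Set ℝ) := u.2.1

theorem subset_unit (u : Config) : (u : Set ℝ) ⊆ Ioo (0 : ℝ) 1 := u.2.2

/-- The complement `[0,1] \ u`, a nonempty compact set. -/
def compl (u : Config) : TopologicalSpace.NonemptyCompacts ℝ where
  carrier := Icc (0 : ℝ) 1 \ (u : Set ℝ)
  isCompact' := isCompact_Icc.diff u.isOpen
  nonempty' := ⟨0, by simp, fun h => lt_irrefl _ (u.subset_unit h).1⟩

theorem compl_injective : Function.Injective compl := by
  intro u v h
  have h' : Icc (0 : ℝ) 1 \ (u : Set ℝ) = Icc (0 : ℝ) 1 \ (v : Set ℝ) :=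
    congrArg (fun K : TopologicalSpace.NonemptyCompacts ℝ => (K : Set ℝ)) h
  have e : ∀ w : Config, Icc (0 : ℝ) 1 \ (Icc (0 : ℝ) 1 \ (w : Set ℝ)) = (w : Set ℝ) := fun w =>
    sdiff_sdiff_cancel_left (w.subset_unit.trans Ioo_subset_Icc_self)
  apply Subtype.ext
  rw [← e u, ← e v, h']

/-- The distance between `u` and `v` is the Hausdorff distance of their complements in `[0,1]`. -/
instance : MetricSpace Config := MetricSpace.induced compl compl_injective inferInstance

/-- The Borel σ-algebra of that distance. -/
instance : MeasurableSpace Config := borel Config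

instance : BorelSpace Config := ⟨rfl⟩

/-- The configuration `(0,1)` with a single fragment. -/
def unit : Config := ⟨Ioo 0 1, isOpen_Ioo, Subset.rfl⟩

/-- The fragments of `u`: its connected components, which are open intervals. -/
def fragments (u : Config) : Set Config :=
  {J | ∃ x ∈ (u : Set ℝ), (J : Set ℝ) = connectedComponentIn (u : Set ℝ) x}

/-- The length `|u|`. -/
def length (u : Config) : ℝ := volume.real (u : Set ℝ)

/-- For an interval `J = (a,b)`, the image of `v` under the affine map `x ↦ a + (b - a) x` of
`(0,1)` onto `J`, written as the set of `y ∈ J` with `(y - a) / (b - a) ∈ v`. -/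
def rescale (J v : Config) : Config :=
  ⟨(J : Set ℝ) ∩ (fun y => (y - sInf (J : Set ℝ)) / (sSup (J : Set ℝ) - sInf (J : Set ℝ))) ⁻¹'
      (v : Set ℝ),
    J.isOpen.inter (v.isOpen.preimage (by fun_prop)),
    inter_subset_left.trans J.subset_unit⟩

/-- The union of a family of configurations. -/
def iUnion {ι : Type*} (X : ι → Config) : Config :=
  ⟨⋃ i, (X i : Set ℝ), isOpen_iUnion fun i => (X i).isOpen,
    iUnion_subset fun i => (X i).subset_unit⟩

end Config

/-- The measure `q^u` obtained from a probability measure `q` on configurations: the law of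
`⋃_J X_J`, the union over the fragments `J` of `u`, where the `X_J` are independent and `X_J` has
the law of the image of a `q`-distributed configuration under the affine map of `(0,1)` onto `J`. -/
def branchLaw (q : ProbabilityMeasure Config) (u : Config) : Measure Config :=
  (Measure.infinitePi fun _ : u.fragments => (q : Measure Config)).map
    fun Y => Config.iUnion fun J => Config.rescale J.1 (Y J)

variable {Ω : Type*} [MeasurableSpace Ω]

/-- The σ-algebra generated by `U s`, `s ≤ t`. -/
abbrev pastσ (U : ℝ≥0 → Ω → Config) (t : ℝ≥0) : MeasurableSpace Ω :=
  ⨆ s ≤ t, MeasurableSpace.comap (U s) inferInstance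

/-- `U` is, under `P`, a conservative homogeneous interval fragmentation with transition data
`q = (q_t : t > 0)` and initial configuration `u`. No length is lost: if `|u| = 1` then
`|U t| = 1` for all `t`. -/
structure IsFragmentation (q : ℝ≥0 → ProbabilityMeasure Config) (u : Config)
    (U : ℝ≥0 → Ω → Config) (P : Measure Ω) : Prop where
  measurable : ∀ t, Measurable (U t)
  initial : ∀ᵐ ω ∂P, U 0 ω = u
  continuous_in_probability : ∀ t, TendstoInMeasure P U (𝓝 t) (U t)
  nested : ∀ᵐ ω ∂P, ∀ s t, s ≤ t → (U t ω : Set ℝ) ⊆ (U s ω : Set ℝ)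
  /-- The Markov property together with the fragmentation property:
  `P(U s ∈ A | U r, r ≤ t) = q_{s-t}^{U t}(A)` for `s > t`. -/
  markov_fragmentation : ∀ t s, t < s → ∀ A : Set Config, MeasurableSet A →
    P⟦U s ⁻¹' A | pastσ U t⟧ =ᵐ[P] fun ω => (branchLaw (q (s - t)) (U t ω)).real A
  conservative : ∀ᵐ ω ∂P, ∀ t, (U t ω).length = u.length

/-- `ξ^x_t = -log I^x(t)`, where `I^x(t)` is the length of the fragment of `U t` containing `x`. -/
def xi (U : ℝ≥0 → Ω → Config) (x : ℝ) (t : ℝ≥0) (ω : Ω) : ℝ :=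
  -Real.log (volume.real (connectedComponentIn (U t ω : Set ℝ) x))

/-- `ζ^x_t = ξ^x_t - c t`. -/
def zeta (c : ℝ) (U : ℝ≥0 → Ω → Config) (x : ℝ) (t : ℝ≥0) (ω : Ω) : ℝ :=
  xi U x t ω - c * t

/-- `∑_{[x]_t} G x`: the sum over the distinct fragments of `w` of the value of `G` at a point `x`
of the fragment. -/
def fragmentSum (w : Config) (G : ℝ → ℝ≥0∞) : ℝ≥0∞ :=
  ∑' J : w.fragments, G J.2.choose

/-- `υ` is uniformly distributed on `(0,1)` and independent of the process `U`. -/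
structure IsUniformTag (υ : Ω → ℝ) (U : ℝ≥0 → Ω → Config) (P : Measure Ω) : Prop where
  measurable : Measurable υ
  uniform : P.map υ = volume.restrict (Ioo (0 : ℝ) 1)
  indep : IndepFun υ (fun ω t => U t ω) P

/-- The randomly tagged process `ξ_t = ξ^υ_t`. -/
def taggedXi (U : ℝ≥0 → Ω → Config) (υ : Ω → ℝ) (t : ℝ≥0) (ω : Ω) : ℝ := xi U (υ ω) t ω

/-- The randomly tagged process `ζ_t = ζ^υ_t`. -/
def taggedZeta (c : ℝ) (U : ℝ≥0 → Ω → Config) (υ : Ω → ℝ) (t : ℝ≥0) (ω : Ω) : ℝ :=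
  zeta c U (υ ω) t ω

/-- The σ-algebra generated by the tag `υ` and by `U s`, `s ≤ t`. -/
abbrev taggedPastσ (U : ℝ≥0 → Ω → Config) (υ : Ω → ℝ) (t : ℝ≥0) : MeasurableSpace Ω :=
  MeasurableSpace.comap υ inferInstance ⊔ pastσ U t

/-- The Laplace exponent `Φ(p) = -log E[exp(-p ξ_1)]`. -/
def Phi (P : Measure Ω) (U : ℝ≥0 → Ω → Config) (υ : Ω → ℝ) (p : ℝ) : ℝ :=
  -Real.log (∫ ω, Real.exp (-p * taggedXi U υ 1 ω) ∂P)

/-- The left end `p̲ ∈ [-1,0]` of the interval of `p ≥ -1` on which `Φ` is finite. -/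
def pLower (P : Measure Ω) (U : ℝ≥0 → Ω → Config) (υ : Ω → ℝ) : ℝ :=
  sInf {p : ℝ | -1 ≤ p ∧ Integrable (fun ω => Real.exp (-p * taggedXi U υ 1 ω)) P}

/-- `p` solves the equation `Φ(p) / (1 + p) = Φ'(p)` in `(p̲, ∞)`. -/
def IsPBar (P : Measure Ω) (U : ℝ≥0 → Ω → Config) (υ : Ω → ℝ) (p : ℝ) : Prop :=
  pLower P U υ < p ∧ Phi P U υ p / (1 + p) = deriv (Phi P U υ) p

/-- The exponential martingale `ℰ_p(t) = exp(Φ(p) t - p ξ_t)`. -/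
def expMart (P : Measure Ω) (U : ℝ≥0 → Ω → Config) (υ : Ω → ℝ) (p : ℝ) (t : ℝ≥0) (ω : Ω) : ℝ :=
  Real.exp (Phi P U υ p * t - p * taggedXi U υ t ω)

/-- `dQ/dP = ℰ_p(t)` on the σ-algebra generated by `υ` and `U s`, `s ≤ t`. -/
def IsTilted (P Q : Measure Ω) (U : ℝ≥0 → Ω → Config) (υ : Ω → ℝ) (p : ℝ) (t : ℝ≥0) : Prop :=
  ∀ A : Set Ω, MeasurableSet[taggedPastσ U υ t] A →
    Q A = ∫⁻ ω in A, ENNReal.ofReal (expMart P U υ p t ω) ∂P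

end Fragmentation

end

noncomputable section

namespace Fragmentation

/-! ### Measurability of components and of fragment lengths -/

namespace Config

/-! A sum over the fragments of `w` is the integral over `w` of the summand divided by the fragment
length (`fragmentSum_eq_lintegral`). Since no length is lost, integrating over `U t` is the same as
integrating over `u`, so the left side is an expectation of `∫_u` of a functional of the path of the
length of the fragment at `x` (`IsFragmentation.lintegral_fragmentSum`).

Seen from a uniform point, this length is a Markov process whose transition operator `tagOp`
commutes with multiplication by constants: inside each fragment the relative position is again
uniform, and the fragment splits like a scaled copy of `(0,1)` (`lintegral_tag_step`). Hence the
path started from `u` is a mixture over the fragments `J`, with weights `|J|`, of `|J|` times the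
path started from `(0,1)`. This is checked on finite-dimensional functionals by induction on the
times (`tagIntegral_eq_tsum`) and extended to path space by a π-system argument
(`lintegral_lengthPath`).

For `(0,1)` the integral over points is the expectation over the tag. The equation for `p` says
`Φ(p) = (1 + p) c`, so the density of `Q` times `exp((p + 1) ζ_t)` is `exp(ξ_t)`, the inverse of the
tagged length (`IsTilted.lintegral_pathWeight`). -/

@[ext] theorem ext {u v : Config} (h : (u : Set ℝ) = (v : Set ℝ)) : u = v := Subtype.ext h

theorem continuous_compl : Continuous compl := continuous_induced_dom

/-- Containing `K` means that the complement lies in the open set `Kᶜ`, which is an open condition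
for the Hausdorff distance. These sets are the only link to the Borel structure: every measurability
proof reduces to them through rational intervals. -/
theorem isOpen_setOf_subset {K : Set ℝ} (hK : IsClosed K) :
    IsOpen {w : Config | K ⊆ (w : Set ℝ)} := by
  by_cases h : K ⊆ Ioo 0 1
  · have h1 : {w : Config | K ⊆ (w : Set ℝ)} =
        compl ⁻¹' {L | (L : Set ℝ) ⊆ Kᶜ} := by
      ext w
      change K ⊆ (w : Set ℝ) ↔ Icc (0 : ℝ) 1 \ (w : Set ℝ) ⊆ Kᶜ
      constructor
      · intro hw x hx hxK
        exact hx.2 (hw hxK)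
      · intro hw x hx
        by_contra hxw
        exact hw ⟨Ioo_subset_Icc_self (h hx), hxw⟩ hx
    rw [h1]
    exact (TopologicalSpace.NonemptyCompacts.isOpen_subsets_of_isOpen hK.isOpen_compl).preimage
      continuous_compl
  · convert isOpen_empty using 1
    ext w
    simp only [mem_ofPred_eq, mem_empty_iff_false, iff_false]
    exact fun hw => h (hw.trans w.subset_unit)

theorem measurableSet_setOf_subset {K : Set ℝ} (hK : IsClosed K) :
    MeasurableSet {w : Config | K ⊆ (w : Set ℝ)} := (isOpen_setOf_subset hK).measurableSet

theorem exists_rat_Icc {w : Config} {x : ℝ} (hx : x ∈ (w : Set ℝ)) :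
    ∃ a b : ℚ, (a : ℝ) < x ∧ x < b ∧ Icc (a : ℝ) b ⊆ (w : Set ℝ) := by
  obtain ⟨l, r, ⟨hl, hr⟩, h⟩ := mem_nhds_iff_exists_Ioo_subset.1 (w.isOpen.mem_nhds hx)
  obtain ⟨a, ha1, ha2⟩ := exists_rat_btwn hl
  obtain ⟨b, hb1, hb2⟩ := exists_rat_btwn hr
  exact ⟨a, b, ha2, hb1, fun y hy => h ⟨ha1.trans_le hy.1, hy.2.trans_lt hb2⟩⟩

/-- The component of `w` at `x` is the open interval between its infimum and supremum. -/
theorem component_eq_Ioo {w : Config} {x : ℝ} (hx : x ∈ (w : Set ℝ)) :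
    connectedComponentIn (w : Set ℝ) x =
      Ioo (sInf (connectedComponentIn (w : Set ℝ) x))
        (sSup (connectedComponentIn (w : Set ℝ) x)) := by
  set C := connectedComponentIn (w : Set ℝ) x with hC
  have hsub : C ⊆ Icc 0 1 :=
    (connectedComponentIn_subset _ _).trans (w.subset_unit.trans Ioo_subset_Icc_self)
  have hb : BddBelow C := bddBelow_Icc.mono hsub
  have ha : BddAbove C := bddAbove_Icc.mono hsub
  have hc : IsConnected C := isConnected_connectedComponentIn_iff.2 hx
  refine Subset.antisymm ?_ (hc.Ioo_csInf_csSup_subset hb ha)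
  have h1 : C ⊆ Icc (sInf C) (sSup C) := subset_Icc_csInf_csSup hb ha
  have h2 := interior_mono h1
  rwa [interior_Icc, (w.isOpen.connectedComponentIn).interior_eq] at h2

theorem mem_component {w : Config} {x : ℝ} (hx : x ∈ (w : Set ℝ)) :
    sInf (connectedComponentIn (w : Set ℝ) x) < x ∧
      x < sSup (connectedComponentIn (w : Set ℝ) x) := by
  have h := mem_connectedComponentIn hx
  rw [component_eq_Ioo hx] at h
  exact h

/-- The length of the fragment of `w` containing `x`, and `0` if there is none. -/
def fragLen (w : Config) (x : ℝ) : ℝ := volume.real (connectedComponentIn (w : Set ℝ) x)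

theorem fragLen_eq_sub (w : Config) (x : ℝ) :
    fragLen w x = sSup (connectedComponentIn (w : Set ℝ) x) -
      sInf (connectedComponentIn (w : Set ℝ) x) := by
  by_cases hx : x ∈ (w : Set ℝ)
  · have h := mem_component hx
    rw [fragLen, component_eq_Ioo hx, Real.volume_real_Ioo_of_le (h.1.trans h.2).le,
      ← component_eq_Ioo hx]
  · simp [fragLen, connectedComponentIn_eq_empty hx]

theorem fragLen_pos {w : Config} {x : ℝ} (hx : x ∈ (w : Set ℝ)) : 0 < fragLen w x := by
  rw [fragLen_eq_sub]
  have h := mem_component hx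
  linarith [h.1, h.2]

theorem measurableSet_mem : MeasurableSet {z : Config × ℝ | z.2 ∈ (z.1 : Set ℝ)} := by
  have h : {z : Config × ℝ | z.2 ∈ (z.1 : Set ℝ)} = ⋃ (a : ℚ) (b : ℚ),
      {w : Config | Icc (a : ℝ) b ⊆ (w : Set ℝ)} ×ˢ Ioo (a : ℝ) b := by
    ext ⟨w, x⟩
    simp only [mem_ofPred_eq, mem_iUnion, mem_prod, mem_Ioo]
    constructor
    · intro hx
      obtain ⟨a, b, ha, hb, h⟩ := exists_rat_Icc hx
      exact ⟨a, b, h, ha, hb⟩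
    · rintro ⟨a, b, h, ha, hb⟩
      exact h ⟨ha.le, hb.le⟩
  rw [h]
  exact MeasurableSet.iUnion fun a => MeasurableSet.iUnion fun b =>
    (measurableSet_setOf_subset isClosed_Icc).prod measurableSet_Ioo

theorem exists_rat_Icc_component {w : Config} {x y z : ℝ} (hx : x ∈ (w : Set ℝ))
    (hy : y ∈ connectedComponentIn (w : Set ℝ) x) (hz : z ∈ connectedComponentIn (w : Set ℝ) x) :
    ∃ a b : ℚ, (a : ℝ) < y ∧ a < z ∧ y < b ∧ z < b ∧ Icc (a : ℝ) b ⊆ (w : Set ℝ) := by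
  have hs : connectedComponentIn (w : Set ℝ) x ⊆ (w : Set ℝ) := connectedComponentIn_subset _ _
  rw [component_eq_Ioo hx] at hy hz hs
  obtain ⟨a, ha1, ha2⟩ := exists_rat_btwn (lt_min hy.1 hz.1)
  obtain ⟨b, hb1, hb2⟩ := exists_rat_btwn (max_lt hy.2 hz.2)
  rw [lt_min_iff] at ha2
  rw [max_lt_iff] at hb1
  exact ⟨a, b, ha2.1, ha2.2, hb1.1, hb1.2,
    fun t ht => hs ⟨ha1.trans_le ht.1, ht.2.trans_lt hb2⟩⟩

theorem mem_component_of_Icc {w : Config} {a b x y : ℝ} (hx : x ∈ Icc a b) (hy : y ∈ Icc a b)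
    (h : Icc a b ⊆ (w : Set ℝ)) : y ∈ connectedComponentIn (w : Set ℝ) x :=
  isPreconnected_Icc.subset_connectedComponentIn hx h hy

theorem bddBelow_component (w : Config) (x : ℝ) :
    BddBelow (connectedComponentIn (w : Set ℝ) x) :=
  bddBelow_Ioo.mono ((connectedComponentIn_subset _ _).trans w.subset_unit)

theorem bddAbove_component (w : Config) (x : ℝ) :
    BddAbove (connectedComponentIn (w : Set ℝ) x) :=
  bddAbove_Ioo.mono ((connectedComponentIn_subset _ _).trans w.subset_unit)

theorem measurable_sInf_component :
    Measurable fun z : Config × ℝ => sInf (connectedComponentIn (z.1 : Set ℝ) z.2) := by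
  refine measurable_of_Iio fun y => ?_
  -- Off `w` the component is empty and its `sInf` is `0`, whence the first set. On `w`, the infimum
  -- is below `y` iff some rational interval around `x` inside `w` starts below `y`.
  have h : (fun z : Config × ℝ => sInf (connectedComponentIn (z.1 : Set ℝ) z.2)) ⁻¹' Iio y =
      ({z : Config × ℝ | z.2 ∈ (z.1 : Set ℝ)}ᶜ ∩ {_z | 0 < y}) ∪ ⋃ (a : ℚ) (b : ℚ),
      {w : Config | (a : ℝ) < y ∧ Icc (a : ℝ) b ⊆ (w : Set ℝ)} ×ˢ Ioo (a : ℝ) b := by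
    ext ⟨w, x⟩
    simp only [mem_preimage, mem_Iio, mem_union, mem_inter_iff, mem_compl_iff, mem_ofPred_eq,
      mem_iUnion, mem_prod, mem_Ioo]
    by_cases hx : x ∈ (w : Set ℝ)
    · simp only [hx, not_true_eq_false, false_and, false_or]
      constructor
      · intro hlt
        obtain ⟨z, hz, hzy⟩ := (csInf_lt_iff (bddBelow_component w x)
          ⟨x, mem_connectedComponentIn hx⟩).1 hlt
        obtain ⟨a, b, h1, h2, h3, h4, h5⟩ :=
          exists_rat_Icc_component hx (mem_connectedComponentIn hx) hz
        exact ⟨a, b, ⟨h2.trans hzy, h5⟩, h1, h3⟩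
      · rintro ⟨a, b, ⟨h1, h2⟩, h3, h4⟩
        have hab : (a : ℝ) ≤ b := (h3.trans h4).le
        exact (csInf_le (bddBelow_component w x)
          (mem_component_of_Icc ⟨h3.le, h4.le⟩ ⟨le_rfl, hab⟩ h2)).trans_lt h1
    · simp only [hx, not_false_eq_true, true_and, connectedComponentIn_eq_empty hx,
        Real.sInf_empty]
      refine ⟨Or.inl, ?_⟩
      rintro (h | ⟨a, b, ⟨-, h2⟩, h3, h4⟩)
      · exact h
      · exact absurd (h2 ⟨h3.le, h4.le⟩) hx
  rw [h]
  refine (measurableSet_mem.compl.inter (.const _)).union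
    (.iUnion fun a => .iUnion fun b => MeasurableSet.prod ?_ measurableSet_Ioo)
  exact (MeasurableSet.const _).inter (measurableSet_setOf_subset isClosed_Icc)

theorem measurable_sSup_component :
    Measurable fun z : Config × ℝ => sSup (connectedComponentIn (z.1 : Set ℝ) z.2) := by
  refine measurable_of_Ioi fun y => ?_
  have h : (fun z : Config × ℝ => sSup (connectedComponentIn (z.1 : Set ℝ) z.2)) ⁻¹' Ioi y =
      ({z : Config × ℝ | z.2 ∈ (z.1 : Set ℝ)}ᶜ ∩ {_z | y < 0}) ∪ ⋃ (a : ℚ) (b : ℚ),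
      {w : Config | y < (b : ℝ) ∧ Icc (a : ℝ) b ⊆ (w : Set ℝ)} ×ˢ Ioo (a : ℝ) b := by
    ext ⟨w, x⟩
    simp only [mem_preimage, mem_Ioi, mem_union, mem_inter_iff, mem_compl_iff, mem_ofPred_eq,
      mem_iUnion, mem_prod, mem_Ioo]
    by_cases hx : x ∈ (w : Set ℝ)
    · simp only [hx, not_true_eq_false, false_and, false_or]
      constructor
      · intro hlt
        obtain ⟨z, hz, hzy⟩ := (lt_csSup_iff (bddAbove_component w x)
          ⟨x, mem_connectedComponentIn hx⟩).1 hlt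
        obtain ⟨a, b, h1, h2, h3, h4, h5⟩ :=
          exists_rat_Icc_component hx (mem_connectedComponentIn hx) hz
        exact ⟨a, b, ⟨hzy.trans h4, h5⟩, h1, h3⟩
      · rintro ⟨a, b, ⟨h1, h2⟩, h3, h4⟩
        have hab : (a : ℝ) ≤ b := (h3.trans h4).le
        exact h1.trans_le (le_csSup (bddAbove_component w x)
          (mem_component_of_Icc ⟨h3.le, h4.le⟩ ⟨hab, le_rfl⟩ h2))
    · simp only [hx, not_false_eq_true, true_and, connectedComponentIn_eq_empty hx,
        Real.sSup_empty]
      refine ⟨Or.inl, ?_⟩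
      rintro (h | ⟨a, b, ⟨-, h2⟩, h3, h4⟩)
      · exact h
      · exact absurd (h2 ⟨h3.le, h4.le⟩) hx
  rw [h]
  refine (measurableSet_mem.compl.inter (.const _)).union
    (.iUnion fun a => .iUnion fun b => MeasurableSet.prod ?_ measurableSet_Ioo)
  exact (MeasurableSet.const _).inter (measurableSet_setOf_subset isClosed_Icc)

theorem measurable_fragLen : Measurable fun z : Config × ℝ => fragLen z.1 z.2 := by
  simp_rw [fragLen_eq_sub]
  exact measurable_sSup_component.sub measurable_sInf_component

theorem fragLen_eq_of_mem {w : Config} {x y : ℝ} (h : y ∈ connectedComponentIn (w : Set ℝ) x) :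
    fragLen w y = fragLen w x := by
  rw [fragLen, fragLen, connectedComponentIn_eq h]

/-- Two points in one fragment at a later time share their fragment at all earlier times. This makes
path functionals constant on the fragments at the final time. -/
theorem fragLen_eq_of_mem_of_subset {v w : Config} (hvw : (v : Set ℝ) ⊆ (w : Set ℝ)) {x y : ℝ}
    (h : y ∈ connectedComponentIn (v : Set ℝ) x) : fragLen w y = fragLen w x :=
  fragLen_eq_of_mem (connectedComponentIn_mono x hvw h)

theorem fragLen_mono {v w : Config} (hvw : (v : Set ℝ) ⊆ (w : Set ℝ)) (x : ℝ) :
    fragLen v x ≤ fragLen w x :=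
  measureReal_mono (connectedComponentIn_mono x hvw)
    ((measure_mono ((connectedComponentIn_subset _ _).trans w.subset_unit)).trans_lt
      measure_Ioo_lt_top).ne

/-! ### Sums over fragments -/

theorem coe_fragment_eq {w : Config} (J : w.fragments) {x : ℝ} (hx : x ∈ (J.1 : Set ℝ)) :
    (J.1 : Set ℝ) = connectedComponentIn (w : Set ℝ) x := by
  obtain ⟨y, -, hy⟩ := J.2
  rw [hy] at hx ⊢
  exact connectedComponentIn_eq hx

theorem fragment_subset {w : Config} (J : w.fragments) : (J.1 : Set ℝ) ⊆ (w : Set ℝ) := by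
  obtain ⟨y, -, hy⟩ := J.2
  rw [hy]
  exact connectedComponentIn_subset _ _

theorem choose_mem_fragment {w : Config} (J : w.fragments) : J.2.choose ∈ (J.1 : Set ℝ) := by
  have h := J.2.choose_spec
  exact h.2.ge (mem_connectedComponentIn h.1)

/-- The fragment of `w` containing `x`. -/
def fragmentAt {w : Config} {x : ℝ} (hx : x ∈ (w : Set ℝ)) : w.fragments :=
  ⟨⟨connectedComponentIn (w : Set ℝ) x, w.isOpen.connectedComponentIn,
    (connectedComponentIn_subset _ _).trans w.subset_unit⟩, x, hx, rfl⟩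

theorem mem_fragmentAt {w : Config} {x : ℝ} (hx : x ∈ (w : Set ℝ)) :
    x ∈ ((fragmentAt hx).1 : Set ℝ) := mem_connectedComponentIn hx

theorem length_fragment {w : Config} (J : w.fragments) {x : ℝ} (hx : x ∈ (J.1 : Set ℝ)) :
    J.1.length = fragLen w x := by
  rw [length, fragLen, coe_fragment_eq J hx]

theorem length_fragment_pos {w : Config} (J : w.fragments) : 0 < J.1.length := by
  rw [length_fragment J (choose_mem_fragment J)]
  exact fragLen_pos (fragment_subset J (choose_mem_fragment J))

theorem pairwise_disjoint_fragments (w : Config) :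
    Pairwise (Function.onFun Disjoint fun J : w.fragments => (J.1 : Set ℝ)) := by
  intro J K hJK
  refine Set.disjoint_left.2 fun x hJ hK => hJK ?_
  apply Subtype.ext
  apply Config.ext
  rw [coe_fragment_eq J hJ, coe_fragment_eq K hK]

instance countable_fragments (w : Config) : Countable w.fragments := by
  have h : (univ : Set w.fragments).Countable :=
    Set.PairwiseDisjoint.countable_of_isOpen (s := fun J : w.fragments => (J.1 : Set ℝ))
      (fun J _ K _ h => pairwise_disjoint_fragments w h) (fun J _ => J.1.isOpen)
      (fun J _ => ⟨_, choose_mem_fragment J⟩)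
  exact Set.countable_univ_iff.1 h

theorem iUnion_fragments (w : Config) : ⋃ J : w.fragments, (J.1 : Set ℝ) = (w : Set ℝ) :=
  Subset.antisymm (iUnion_subset fun J => fragment_subset J)
    fun _ hx => mem_iUnion.2 ⟨fragmentAt hx, mem_fragmentAt hx⟩

theorem setLIntegral_eq_tsum_fragments (w : Config) (f : ℝ → ℝ≥0∞) :
    ∫⁻ x in (w : Set ℝ), f x = ∑' J : w.fragments, ∫⁻ x in (J.1 : Set ℝ), f x := by
  conv_lhs => rw [← iUnion_fragments w]
  exact lintegral_iUnion (fun J => J.1.isOpen.measurableSet) (pairwise_disjoint_fragments w) f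

theorem volume_ne_top (w : Config) : volume (w : Set ℝ) ≠ ∞ :=
  ((measure_mono w.subset_unit).trans_lt measure_Ioo_lt_top).ne

theorem volume_eq_ofReal_length (w : Config) : volume (w : Set ℝ) = ENNReal.ofReal w.length :=
  (ofReal_measureReal w.volume_ne_top).symm

/-- A sum over fragments is an integral with respect to a uniform point, biased by the inverse
of the length. -/
theorem _root_.Fragmentation.fragmentSum_eq_lintegral (w : Config) (G : ℝ → ℝ≥0∞)
    (hG : ∀ x ∈ (w : Set ℝ), ∀ y ∈ connectedComponentIn (w : Set ℝ) x, G y = G x) :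
    fragmentSum w G = ∫⁻ x in (w : Set ℝ), ENNReal.ofReal (fragLen w x)⁻¹ * G x := by
  rw [fragmentSum, setLIntegral_eq_tsum_fragments]
  refine tsum_congr fun J => ?_
  have hc := choose_mem_fragment J
  set y := J.2.choose
  have h1 : ∫⁻ x in (J.1 : Set ℝ), ENNReal.ofReal (fragLen w x)⁻¹ * G x =
      ∫⁻ _ in (J.1 : Set ℝ), ENNReal.ofReal J.1.length⁻¹ * G y := by
    refine setLIntegral_congr_fun J.1.isOpen.measurableSet fun x hx => ?_
    have hxy : x ∈ connectedComponentIn (w : Set ℝ) y := by rwa [← coe_fragment_eq J hc]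
    simp only [length_fragment J hx, hG y (fragment_subset J hc) x hxy]
  rw [h1, setLIntegral_const, volume_eq_ofReal_length, mul_right_comm,
    ← ENNReal.ofReal_mul (inv_nonneg.2 (length_fragment_pos J).le),
    inv_mul_cancel₀ (length_fragment_pos J).ne', ENNReal.ofReal_one, one_mul]

/-! ### Rescaling -/

open scoped Pointwise in
theorem volume_real_image_affine (a b : ℝ) (s : Set ℝ) :
    volume.real ((fun x => a * x + b) '' s) = |a| * volume.real s := by
  have h : (fun x => a * x + b) '' s = (fun x => x + b) '' (a • s) := by
    rw [← image_smul, image_image]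
    rfl
  rw [h, image_add_right, measureReal_def, measure_preimage_add_right, Measure.addHaar_smul,
    measureReal_def, ENNReal.toReal_mul]
  simp

theorem connectedComponentIn_inter_of_subset {s t : Set ℝ} {x : ℝ}
    (h : connectedComponentIn s x ⊆ t) :
    connectedComponentIn (s ∩ t) x = connectedComponentIn s x := by
  refine Subset.antisymm (connectedComponentIn_mono x inter_subset_left) ?_
  by_cases hx : x ∈ s
  · exact isPreconnected_connectedComponentIn.subset_connectedComponentIn
      (mem_connectedComponentIn hx) (subset_inter (connectedComponentIn_subset _ _) h)
  · rw [connectedComponentIn_eq_empty hx]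
    exact empty_subset _

theorem rescale_eq_image {a b : ℝ} (hab : a < b) {J : Config} (hJ : (J : Set ℝ) = Ioo a b)
    (v : Config) :
    (rescale J v : Set ℝ) = affineHomeomorph (b - a) a (sub_pos.2 hab).ne' '' (v : Set ℝ) := by
  have hba := sub_pos.2 hab
  ext y
  simp only [rescale, hJ, csInf_Ioo hab, csSup_Ioo hab, mem_inter_iff, mem_preimage, mem_image]
  constructor
  · rintro ⟨-, hy⟩
    refine ⟨_, hy, ?_⟩
    simp [affineHomeomorph_apply]
    field_simp
    ring
  · rintro ⟨z, hz, rfl⟩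
    have hz1 := v.subset_unit hz
    have : (b - a) * z + a - a = (b - a) * z := by ring
    rw [affineHomeomorph_apply, this, mul_div_cancel_left₀ _ hba.ne']
    refine ⟨⟨?_, ?_⟩, hz⟩
    · nlinarith [mul_pos hba hz1.1]
    · nlinarith [mul_pos hba (sub_pos.2 hz1.2)]

theorem iUnion_rescale_subset {w : Config} (Y : w.fragments → Config) :
    (iUnion (fun J : w.fragments => rescale J.1 (Y J)) : Set ℝ) ⊆ (w : Set ℝ) :=
  iUnion_subset fun J => inter_subset_left.trans (fragment_subset J)

theorem iUnion_rescale_inter {w : Config} (Y : w.fragments → Config) (J : w.fragments) :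
    (iUnion (fun J : w.fragments => rescale J.1 (Y J)) : Set ℝ) ∩ (J.1 : Set ℝ) =
      (rescale J.1 (Y J) : Set ℝ) := by
  ext y
  constructor
  · rintro ⟨hy, hyJ⟩
    obtain ⟨K, hK⟩ := mem_iUnion.1 hy
    have : K = J := by
      by_contra hne
      exact Set.disjoint_left.1 (pairwise_disjoint_fragments w hne) hK.1 hyJ
    rwa [← this]
  · exact fun hy => ⟨mem_iUnion.2 ⟨J, hy⟩, hy.1⟩

/-- Fragment lengths of a configuration obtained by splitting each fragment `J` of `w` according
to `Y J`. -/
theorem fragLen_iUnion_rescale {w : Config} (Y : w.fragments → Config) {x : ℝ}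
    (hx : x ∈ (w : Set ℝ)) :
    fragLen (iUnion fun J : w.fragments => rescale J.1 (Y J)) x =
      fragLen w x * fragLen (Y (fragmentAt hx))
        ((x - sInf (connectedComponentIn (w : Set ℝ) x)) / fragLen w x) := by
  set J := fragmentAt hx
  set v := iUnion fun J : w.fragments => rescale J.1 (Y J)
  have hJ : (J.1 : Set ℝ) = connectedComponentIn (w : Set ℝ) x := rfl
  have hIoo := component_eq_Ioo hx
  have hmem := mem_component hx
  have hlen := fragLen_eq_sub w x
  set a := sInf (connectedComponentIn (w : Set ℝ) x)
  set b := sSup (connectedComponentIn (w : Set ℝ) x)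
  have hab : a < b := hmem.1.trans hmem.2
  have hba := sub_pos.2 hab
  -- As `v ⊆ w`, the component of `v` at `x` stays inside `J`, where `v` is just the rescaled `Y J`.
  have h1 : connectedComponentIn (v : Set ℝ) x =
      connectedComponentIn (rescale J.1 (Y J) : Set ℝ) x := by
    rw [← iUnion_rescale_inter Y J]
    refine (connectedComponentIn_inter_of_subset ?_).symm
    rw [hJ]
    exact connectedComponentIn_mono x (iUnion_rescale_subset Y)
  rw [fragLen, h1, rescale_eq_image hab (hJ.trans hIoo), hlen]
  set φ := affineHomeomorph (b - a) a (sub_pos.2 hab).ne'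
  have hφ : φ ((x - a) / (b - a)) = x := by
    simp only [φ, affineHomeomorph_apply]
    field_simp
    ring
  by_cases hy : (x - a) / (b - a) ∈ (Y J : Set ℝ)
  · have h2 := φ.image_connectedComponentIn hy
    rw [hφ] at h2
    rw [← h2]
    have h3 := volume_real_image_affine (b - a) a
      (connectedComponentIn (Y J : Set ℝ) ((x - a) / (b - a)))
    rw [abs_of_pos hba] at h3
    exact h3
  · have h2 : x ∉ φ '' (Y J : Set ℝ) := by
      rintro ⟨z, hz, hzx⟩
      rw [← hφ] at hzx
      exact hy (φ.injective hzx ▸ hz)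
    rw [connectedComponentIn_eq_empty h2, fragLen, connectedComponentIn_eq_empty hy]
    simp

theorem fragLen_iUnion_rescale_of_notMem {w : Config} (Y : w.fragments → Config) {x : ℝ}
    (hx : x ∉ (w : Set ℝ)) :
    fragLen (iUnion fun J : w.fragments => rescale J.1 (Y J)) x = 0 := by
  rw [fragLen, connectedComponentIn_eq_empty fun h => hx (iUnion_rescale_subset Y h)]
  simp

theorem fragments_unit : (unit.fragments) = {unit} := by
  have h : ∀ x ∈ Ioo (0 : ℝ) 1, connectedComponentIn (Ioo (0 : ℝ) 1) x = Ioo 0 1 := fun x hx =>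
    isPreconnected_Ioo.connectedComponentIn hx
  ext J
  simp only [fragments, mem_ofPred_eq, mem_singleton_iff]
  constructor
  · rintro ⟨x, hx, hJ⟩
    exact Config.ext (hJ.trans (h x hx))
  · rintro rfl
    exact ⟨1 / 2, by simp [unit]; norm_num, (h _ (by norm_num)).symm⟩

theorem length_unit : unit.length = 1 := by
  simp [length, unit]

end Config

end Fragmentation

end

/-! ### One-step Markov property of the tagged fragment length -/

noncomputable section

namespace Fragmentation

open Config

/-- The transition operator of the length of the fragment containing a uniform tag. -/
def tagOp (q : ProbabilityMeasure Config) (h : ℝ → ℝ≥0∞) (l : ℝ) : ℝ≥0∞ :=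
  ∫⁻ y in Ioo (0 : ℝ) 1, ∫⁻ v, h (l * fragLen v y) ∂(q : Measure Config)

theorem measurable_lintegral_fragLen (q : ProbabilityMeasure Config) {h : ℝ → ℝ≥0∞}
    (hh : Measurable h) :
    Measurable fun z : ℝ × ℝ => ∫⁻ v, h (z.1 * fragLen v z.2) ∂(q : Measure Config) := by
  refine Measurable.lintegral_prod_right' (f := fun z : (ℝ × ℝ) × Config =>
    h (z.1.1 * fragLen z.2 z.1.2)) (hh.comp ?_)
  exact measurable_fst.fst.mul
    (measurable_fragLen.comp (measurable_snd.prodMk measurable_fst.snd))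

theorem measurable_tagOp (q : ProbabilityMeasure Config) {h : ℝ → ℝ≥0∞} (hh : Measurable h) :
    Measurable (tagOp q h) :=
  (measurable_lintegral_fragLen q hh).lintegral_prod_right (ν := volume.restrict (Ioo 0 1))

/-- Homogeneity: this lets the induction in `tagIntegral_eq_tsum` carry the factor `|J|` through
each transition. -/
theorem tagOp_comp_mul (q : ProbabilityMeasure Config) (h : ℝ → ℝ≥0∞) (a : ℝ) :
    tagOp q (fun x => h (a * x)) = fun l => tagOp q h (a * l) := by
  funext l
  simp only [tagOp, mul_assoc]

/-- `Measure.map` along a map that is not a.e. measurable is zero, so total mass one forces the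
gluing map to be a.e. measurable. -/
theorem aemeasurable_of_branchLaw_univ {q : ProbabilityMeasure Config} {w : Config}
    (h : (branchLaw q w).real univ = 1) :
    AEMeasurable (fun Y : w.fragments → Config => Config.iUnion fun J => rescale J.1 (Y J))
      (Measure.infinitePi fun _ : w.fragments => (q : Measure Config)) := by
  by_contra hn
  rw [branchLaw, Measure.map_of_not_aemeasurable hn] at h
  simp at h

/-- Only the coordinate of the fragment containing `x` matters, and its marginal is `q`. If `x ∉ w`,
both sides are `h 0`. -/
theorem lintegral_branchLaw_fragLen {q : ProbabilityMeasure Config} {w : Config}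
    (hw : (branchLaw q w).real univ = 1) {h : ℝ → ℝ≥0∞} (hh : Measurable h) (x : ℝ) :
    ∫⁻ v, h (fragLen v x) ∂(branchLaw q w) =
      ∫⁻ v, h (fragLen w x * fragLen v
        ((x - sInf (connectedComponentIn (w : Set ℝ) x)) / fragLen w x)) ∂(q : Measure Config) := by
  have hsec : ∀ y : ℝ, Measurable fun v : Config => fragLen v y := fun y =>
    measurable_fragLen.comp (measurable_id.prodMk measurable_const)
  rw [branchLaw, lintegral_map' (f := fun v => h (fragLen v x)) (hh.comp (hsec x)).aemeasurable
    (aemeasurable_of_branchLaw_univ hw)]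
  by_cases hx : x ∈ (w : Set ℝ)
  · simp only [fragLen_iUnion_rescale _ hx]
    exact (measurePreserving_eval_infinitePi (fun _ : w.fragments => (q : Measure Config))
      (fragmentAt hx)).lintegral_comp (f := fun v => h (fragLen w x * fragLen v
        ((x - sInf (connectedComponentIn (w : Set ℝ) x)) / fragLen w x)))
      (hh.comp ((hsec _).const_mul _))
  · have h0 : fragLen w x = 0 := by
      rw [fragLen, connectedComponentIn_eq_empty hx]
      simp
    simp [fragLen_iUnion_rescale_of_notMem _ hx, h0]

theorem setLIntegral_Ioo_affine {a b : ℝ} (hab : a < b) (k : ℝ → ℝ≥0∞) :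
    ∫⁻ x in Ioo a b, k ((x - a) / (b - a)) =
      ENNReal.ofReal (b - a) * ∫⁻ y in Ioo (0 : ℝ) 1, k y := by
  have hba := sub_pos.2 hab
  have himg : (fun y : ℝ => (b - a) * y + a) '' Ioo 0 1 = Ioo a b := by
    have := image_affine_Ioo (c := 0) (d := 1) hba a
    simpa using this
  rw [← himg, lintegral_image_eq_lintegral_abs_deriv_mul measurableSet_Ioo
    (f' := fun _ => b - a) (fun x _ => ?_) (fun x _ y _ hxy => ?_),
    lintegral_const_mul' _ _ (by simp), abs_of_pos hba]
  · congr 1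
    refine lintegral_congr fun y => ?_
    congr 1
    field_simp
    ring
  · simpa using (((hasDerivAt_id x).const_mul (b - a)).add_const a).hasDerivWithinAt
  · simpa [hba.ne'] using hxy

/-- Averaging over the relative position inside each fragment. -/
theorem setLIntegral_relative_position (w : Config) (Γ : ℝ → ℝ≥0∞) (H : ℝ → ℝ → ℝ≥0∞)
    (hΓ : ∀ x ∈ (w : Set ℝ), ∀ y ∈ connectedComponentIn (w : Set ℝ) x, Γ y = Γ x)
    (hH : ∀ l, Measurable (H l)) :
    ∫⁻ x in (w : Set ℝ), Γ x * H (fragLen w x)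
        ((x - sInf (connectedComponentIn (w : Set ℝ) x)) / fragLen w x) =
      ∫⁻ x in (w : Set ℝ), Γ x * ∫⁻ y in Ioo (0 : ℝ) 1, H (fragLen w x) y := by
  rw [setLIntegral_eq_tsum_fragments, setLIntegral_eq_tsum_fragments]
  refine tsum_congr fun J => ?_
  have hc := choose_mem_fragment J
  set c := J.2.choose
  have hcw : c ∈ (w : Set ℝ) := fragment_subset J hc
  have hJc := coe_fragment_eq J hc
  have hIoo := hJc.trans (component_eq_Ioo hcw)
  have hmem := mem_component hcw
  have hlen := fragLen_eq_sub w c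
  set a := sInf (connectedComponentIn (w : Set ℝ) c) with ha
  set b := sSup (connectedComponentIn (w : Set ℝ) c)
  have hab : a < b := hmem.1.trans hmem.2
  have hL : ∫⁻ x in (J.1 : Set ℝ), Γ x * H (fragLen w x)
        ((x - sInf (connectedComponentIn (w : Set ℝ) x)) / fragLen w x) =
      ∫⁻ x in (J.1 : Set ℝ), Γ c * H (b - a) ((x - a) / (b - a)) := by
    refine setLIntegral_congr_fun J.1.isOpen.measurableSet fun x hx => ?_
    have hxc : x ∈ connectedComponentIn (w : Set ℝ) c := by rwa [← hJc]
    simp only [hΓ c hcw x hxc, fragLen_eq_of_mem hxc, ← connectedComponentIn_eq hxc, ← ha, hlen]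
  have hR : ∫⁻ x in (J.1 : Set ℝ), Γ x * ∫⁻ y in Ioo (0 : ℝ) 1, H (fragLen w x) y =
      ∫⁻ x in (J.1 : Set ℝ), Γ c * ∫⁻ y in Ioo (0 : ℝ) 1, H (b - a) y := by
    refine setLIntegral_congr_fun J.1.isOpen.measurableSet fun x hx => ?_
    have hxc : x ∈ connectedComponentIn (w : Set ℝ) c := by rwa [← hJc]
    simp only [hΓ c hcw x hxc, fragLen_eq_of_mem hxc, hlen]
  have hmeas : Measurable fun x => H (b - a) ((x - a) / (b - a)) :=
    (hH _).comp ((measurable_id.sub_const a).div_const (b - a))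
  rw [hL, hR, lintegral_const_mul _ hmeas, setLIntegral_const, hIoo,
    setLIntegral_Ioo_affine hab, Real.volume_Ioo, mul_assoc, mul_comm (ENNReal.ofReal _)]

variable {Ω : Type*} [MeasurableSpace Ω]

theorem pastσ_le {U : ℝ≥0 → Ω → Config} (hU : ∀ t, Measurable (U t)) (t : ℝ≥0) :
    pastσ U t ≤ ‹MeasurableSpace Ω› :=
  iSup₂_le fun s _ => (hU s).comap_le

omit [MeasurableSpace Ω] in
theorem measurable_pastσ (U : ℝ≥0 → Ω → Config) {s t : ℝ≥0} (hst : s ≤ t) :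
    Measurable[pastσ U t] (U s) := by
  rw [measurable_iff_comap_le]
  exact le_iSup₂_of_le s hst le_rfl

namespace IsFragmentation

variable {q : ℝ≥0 → ProbabilityMeasure Config} {u : Config} {U : ℝ≥0 → Ω → Config}
  {P : Measure Ω} [IsProbabilityMeasure P]

instance isFiniteMeasure_branchLaw (q : ProbabilityMeasure Config) (w : Config) :
    IsFiniteMeasure (branchLaw q w) := by
  unfold branchLaw
  infer_instance

/-- The Markov property with `A = univ`; it supplies the hypothesis of
`aemeasurable_of_branchLaw_univ` along the process. -/
theorem ae_branchLaw_univ (hU : IsFragmentation q u U P) {r m : ℝ≥0} (hrm : r < m) :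
    ∀ᵐ ω ∂P, (branchLaw (q (m - r)) (U r ω)).real univ = 1 := by
  have h := hU.markov_fragmentation r m hrm univ .univ
  have h1 : P⟦U m ⁻¹' univ | pastσ U r⟧ = fun _ => (1 : ℝ) := by
    rw [preimage_univ, indicator_univ]
    exact condExp_const (pastσ_le hU.measurable r) 1
  rw [h1] at h
  filter_upwards [h] with ω hω
  exact hω.symm

omit [IsProbabilityMeasure P] in
-- Measurability is inherited from the conditional probability with which this function agrees a.e.
theorem aemeasurable_branchLaw_apply (hU : IsFragmentation q u U P) {r m : ℝ≥0} (hrm : r < m)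
    {A : Set Config} (hA : MeasurableSet A) :
    AEMeasurable (fun ω => branchLaw (q (m - r)) (U r ω) A) P := by
  have h := hU.markov_fragmentation r m hrm A hA
  have h1 : AEMeasurable (fun ω => (branchLaw (q (m - r)) (U r ω)).real A) P :=
    (integrable_condExp.aestronglyMeasurable.aemeasurable).congr h
  refine h1.ennreal_ofReal.congr (ae_of_all _ fun ω => ?_)
  exact ofReal_measureReal (measure_ne_top _ _)

theorem measure_inter_preimage (hU : IsFragmentation q u U P) {r m : ℝ≥0} (hrm : r < m)
    {A : Set Config} (hA : MeasurableSet A) {B : Set Ω} (hB : MeasurableSet[pastσ U r] B) :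
    P (B ∩ U m ⁻¹' A) = ∫⁻ ω in B, branchLaw (q (m - r)) (U r ω) A ∂P := by
  have hle := pastσ_le hU.measurable r
  have hAm : MeasurableSet (U m ⁻¹' A) := hU.measurable m hA
  have h := hU.markov_fragmentation r m hrm A hA
  have hint : Integrable ((U m ⁻¹' A).indicator fun _ => (1 : ℝ)) P :=
    (integrable_const 1).indicator hAm
  have h1 := setIntegral_condExp hle hint hB
  rw [setIntegral_congr_ae (hle B hB) (h.mono fun ω hω _ => hω), setIntegral_indicator hAm] at h1
  simp only [integral_const, smul_eq_mul, mul_one, measureReal_restrict_apply_univ] at h1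
  rw [← ofReal_measureReal, ← h1, ofReal_integral_eq_lintegral_ofReal]
  · exact lintegral_congr fun ω => ofReal_measureReal (measure_ne_top _ _)
  · exact (integrable_condExp.congr h).integrableOn
  · exact ae_of_all _ fun ω => measureReal_nonneg

theorem lintegral_mul_indicator (hU : IsFragmentation q u U P) {r m : ℝ≥0} (hrm : r < m)
    {A : Set Config} (hA : MeasurableSet A) {Γ : Ω → ℝ≥0∞} (hΓ : Measurable[pastσ U r] Γ) :
    ∫⁻ ω in U m ⁻¹' A, Γ ω ∂P = ∫⁻ ω, Γ ω * branchLaw (q (m - r)) (U r ω) A ∂P := by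
  have hle := pastσ_le hU.measurable r
  have hd := hU.aemeasurable_branchLaw_apply hrm hA
  -- `Γ` is measurable for the past, so the two measures need only agree on the past σ-algebra.
  have h1 : (P.restrict (U m ⁻¹' A)).trim hle =
      (P.withDensity fun ω => branchLaw (q (m - r)) (U r ω) A).trim hle := by
    refine @Measure.ext _ (pastσ U r) _ _ fun B hB => ?_
    rw [trim_measurableSet_eq hle hB, trim_measurableSet_eq hle hB,
      Measure.restrict_apply (hle B hB), withDensity_apply _ (hle B hB),
      hU.measure_inter_preimage hrm hA hB]
  rw [← lintegral_trim hle hΓ, h1, lintegral_trim hle hΓ,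
    lintegral_withDensity_eq_lintegral_mul₀ hd (hΓ.mono hle le_rfl).aemeasurable]
  exact lintegral_congr fun ω => mul_comm _ _

/-- The Markov property for nonnegative functions. -/
theorem lintegral_mul_comp (hU : IsFragmentation q u U P) {r m : ℝ≥0} (hrm : r < m)
    {Γ : Ω → ℝ≥0∞} (hΓ : Measurable[pastσ U r] Γ) {k : Config → ℝ≥0∞} (hk : Measurable k) :
    AEMeasurable (fun ω => ∫⁻ v, k v ∂(branchLaw (q (m - r)) (U r ω))) P ∧
      ∫⁻ ω, Γ ω * k (U m ω) ∂P =
        ∫⁻ ω, Γ ω * ∫⁻ v, k v ∂(branchLaw (q (m - r)) (U r ω)) ∂P := by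
  have hle := pastσ_le hU.measurable r
  have hΓ' : Measurable Γ := hΓ.mono hle le_rfl
  refine Measurable.ennreal_induction (motive := fun k : Config → ℝ≥0∞ =>
    AEMeasurable (fun ω => ∫⁻ v, k v ∂(branchLaw (q (m - r)) (U r ω))) P ∧
      ∫⁻ ω, Γ ω * k (U m ω) ∂P =
        ∫⁻ ω, Γ ω * ∫⁻ v, k v ∂(branchLaw (q (m - r)) (U r ω)) ∂P) ?_ ?_ ?_ hk
  · intro c A hA
    simp only [lintegral_indicator_const hA]
    refine ⟨(hU.aemeasurable_branchLaw_apply hrm hA).const_mul c, ?_⟩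
    have h1 : ∀ ω, Γ ω * A.indicator (fun _ => c) (U m ω) =
        c * (U m ⁻¹' A).indicator Γ ω := by
      intro ω
      by_cases hω : U m ω ∈ A
      · simp [hω, mul_comm]
      · simp [hω]
    simp only [h1, mul_left_comm _ c]
    rw [lintegral_const_mul _ (hΓ'.indicator (hU.measurable m hA)),
      lintegral_indicator (hU.measurable m hA),
      lintegral_const_mul'' (f := fun ω => Γ ω * branchLaw (q (m - r)) (U r ω) A) _
        (hΓ'.aemeasurable.mul (hU.aemeasurable_branchLaw_apply hrm hA)),
      hU.lintegral_mul_indicator hrm hA hΓ]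
  · intro f g _ hf hg ihf ihg
    simp only [Pi.add_apply, lintegral_add_left hf, mul_add]
    refine ⟨ihf.1.add ihg.1, ?_⟩
    rw [lintegral_add_left (f := fun ω => Γ ω * f (U m ω))
        (hΓ'.mul (hf.comp (hU.measurable m))),
      lintegral_add_left' (f := fun ω => Γ ω * ∫⁻ v, f v ∂(branchLaw (q (m - r)) (U r ω)))
        (hΓ'.aemeasurable.mul ihf.1), ihf.2, ihg.2]
  · intro f hf hmono ih
    simp only [lintegral_iSup hf hmono, ENNReal.mul_iSup]
    refine ⟨AEMeasurable.iSup fun n => (ih n).1, ?_⟩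
    rw [lintegral_iSup (f := fun n ω => Γ ω * f n (U m ω))
        (fun n => hΓ'.mul ((hf n).comp (hU.measurable m)))
        (fun i j hij ω => mul_le_mul_right (hmono hij _) _),
      lintegral_iSup' (f := fun n ω => Γ ω * ∫⁻ v, f n v ∂(branchLaw (q (m - r)) (U r ω)))
        (fun n => hΓ'.aemeasurable.mul (ih n).1)
        (ae_of_all _ fun ω i j hij => mul_le_mul_right (lintegral_mono (hmono hij)) _)]
    exact iSup_congr fun n => (ih n).2

omit [IsProbabilityMeasure P] in
-- Nestedness and equal finite length leave only a null set between `U t` and `u`, for all `t` at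
-- once.
theorem ae_forall_aeEq (hU : IsFragmentation q u U P) :
    ∀ᵐ ω ∂P, ∀ t, (U t ω : Set ℝ) ⊆ (u : Set ℝ) ∧
      (U t ω : Set ℝ) =ᵐ[volume] (u : Set ℝ) := by
  filter_upwards [hU.initial, hU.nested, hU.conservative] with ω h0 hn hc t
  have hs : (U t ω : Set ℝ) ⊆ (u : Set ℝ) := by
    rw [← h0]
    exact hn 0 t zero_le
  refine ⟨hs, ae_eq_of_subset_of_measure_ge hs ?_
    (U t ω).isOpen.measurableSet.nullMeasurableSet (volume_ne_top u)⟩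
  rw [volume_eq_ofReal_length, volume_eq_ofReal_length, hc t]

omit [IsProbabilityMeasure P] in
theorem ae_setLIntegral_eq (hU : IsFragmentation q u U P) :
    ∀ᵐ ω ∂P, ∀ t, ∀ f : ℝ → ℝ≥0∞,
      ∫⁻ x in (u : Set ℝ), f x = ∫⁻ x in (U t ω : Set ℝ), f x := by
  filter_upwards [hU.ae_forall_aeEq] with ω h t f
  rw [Measure.restrict_congr_set (h t).2]

theorem measurable_fragLen_process (hU : ∀ t, Measurable (U t)) (t : ℝ≥0) :
    Measurable fun z : Ω × ℝ => fragLen (U t z.1) z.2 :=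
  measurable_fragLen.comp (((hU t).comp measurable_fst).prodMk measurable_snd)

/-- One-step Markov property of the length of a uniformly tagged fragment. -/
theorem lintegral_tag_step (hU : IsFragmentation q u U P) {r m : ℝ≥0} (hrm : r < m)
    {Γ : Ω → ℝ → ℝ≥0∞} (hΓ : Measurable (Function.uncurry Γ))
    (hpast : ∀ x, Measurable[pastσ U r] fun ω => Γ ω x)
    (hconst : ∀ᵐ ω ∂P, ∀ x ∈ (U r ω : Set ℝ),
      ∀ y ∈ connectedComponentIn (U r ω : Set ℝ) x, Γ ω y = Γ ω x)
    {h : ℝ → ℝ≥0∞} (hh : Measurable h) :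
    ∫⁻ ω, (∫⁻ x in (u : Set ℝ), Γ ω x * h (fragLen (U m ω) x)) ∂P =
      ∫⁻ ω, (∫⁻ x in (u : Set ℝ), Γ ω x * tagOp (q (m - r)) h (fragLen (U r ω) x)) ∂P := by
  set H : ℝ → ℝ → ℝ≥0∞ := fun l y =>
    ∫⁻ v, h (l * fragLen v y) ∂(q (m - r) : Measure Config) with hHdef
  have hH : Measurable (Function.uncurry H) := measurable_lintegral_fragLen _ hh
  have hlen := measurable_fragLen_process hU.measurable r
  have hinf : Measurable fun z : Ω × ℝ => sInf (connectedComponentIn (U r z.1 : Set ℝ) z.2) :=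
    measurable_sInf_component.comp
      (((hU.measurable r).comp measurable_fst).prodMk measurable_snd)
  -- For fixed `x` the relative position in its fragment is not uniform. The Markov property is
  -- applied pointwise in `x`, and uniformity appears only after Tonelli and integration over `x`.
  have hpoint : ∀ x, ∫⁻ ω, Γ ω x * h (fragLen (U m ω) x) ∂P =
      ∫⁻ ω, Γ ω x * H (fragLen (U r ω) x)
        ((x - sInf (connectedComponentIn (U r ω : Set ℝ) x)) / fragLen (U r ω) x) ∂P := by
    intro x
    have hk : Measurable fun v : Config => h (fragLen v x) :=
      hh.comp (measurable_fragLen.comp (measurable_id.prodMk measurable_const))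
    rw [(hU.lintegral_mul_comp hrm (hpast x) hk).2]
    refine lintegral_congr_ae ?_
    filter_upwards [hU.ae_branchLaw_univ hrm] with ω hω
    rw [lintegral_branchLaw_fragLen hω hh x]
  have hm1 : Measurable fun z : Ω × ℝ => Γ z.1 z.2 * h (fragLen (U m z.1) z.2) :=
    hΓ.mul (hh.comp (measurable_fragLen_process hU.measurable m))
  have hm2 : Measurable fun z : Ω × ℝ => Γ z.1 z.2 * H (fragLen (U r z.1) z.2)
      ((z.2 - sInf (connectedComponentIn (U r z.1 : Set ℝ) z.2)) / fragLen (U r z.1) z.2) :=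
    hΓ.mul (hH.comp (hlen.prodMk ((measurable_snd.sub hinf).div hlen)))
  rw [lintegral_lintegral_swap hm1.aemeasurable]
  simp only [hpoint]
  rw [← lintegral_lintegral_swap hm2.aemeasurable]
  refine lintegral_congr_ae ?_
  filter_upwards [hU.ae_setLIntegral_eq, hconst] with ω hω hc
  rw [hω r, hω r]
  exact setLIntegral_relative_position (U r ω) (Γ ω) H hc fun l => hH.of_uncurry_left

end IsFragmentation

end Fragmentation

end

/-! ### From finite-dimensional laws to the law of the length path -/

noncomputable section

namespace Fragmentation

open Config

variable {Ω Ω' : Type*} [MeasurableSpace Ω] [MeasurableSpace Ω']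

/-- A finite-dimensional functional of the length of the fragment containing a uniform tag. -/
def tagIntegral (P : Measure Ω) (u : Config) (U : ℝ≥0 → Ω → Config) {t : ℝ≥0}
    (I : Finset (Iic t)) (g : Iic t → ℝ → ℝ≥0∞) (m : Iic t) (h : ℝ → ℝ≥0∞) : ℝ≥0∞ :=
  ∫⁻ ω, (∫⁻ x in (u : Set ℝ),
    (∏ s ∈ I, g s (fragLen (U s ω) x)) * h (fragLen (U m ω) x)) ∂P

/-- The factor at the last time is absorbed into `h`, the slot on which `tagOp` acts. -/
theorem tagIntegral_insert (P : Measure Ω) (u : Config) (U : ℝ≥0 → Ω → Config) {t : ℝ≥0}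
    {I : Finset (Iic t)} {a : Iic t} (ha : a ∉ I) (g : Iic t → ℝ → ℝ≥0∞) (h : ℝ → ℝ≥0∞) :
    tagIntegral P u U (insert a I) g a h =
      tagIntegral P u U I g a (fun l => g a l * h l) := by
  simp only [tagIntegral, Finset.prod_insert ha]
  simp only [mul_left_comm, mul_assoc]

/-- The initial time as an index of the path up to `t`. -/
def zeroTime (t : ℝ≥0) : Iic t := ⟨0, mem_Iic.2 zero_le⟩

namespace IsFragmentation

variable {q : ℝ≥0 → ProbabilityMeasure Config} {u : Config} {U : ℝ≥0 → Ω → Config}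
  {P : Measure Ω} [IsProbabilityMeasure P] {t : ℝ≥0}

theorem tagIntegral_step (hU : IsFragmentation q u U P) {I : Finset (Iic t)} {r m : Iic t}
    (hI : ∀ s ∈ I, s ≤ r) (hrm : r < m) {g : Iic t → ℝ → ℝ≥0∞} (hg : ∀ s, Measurable (g s))
    {h : ℝ → ℝ≥0∞} (hh : Measurable h) :
    tagIntegral P u U I g m h =
      tagIntegral P u U I g r (tagOp (q ((m : ℝ≥0) - r)) h) := by
  refine hU.lintegral_tag_step (r := r) (m := m) hrm
    (Γ := fun ω x => ∏ s ∈ I, g s (fragLen (U s ω) x)) ?_ ?_ ?_ hh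
  · exact Finset.measurable_prod _ fun s _ =>
      (hg s).comp (measurable_fragLen_process hU.measurable s)
  · intro x
    refine Finset.measurable_prod _ fun s hs => (hg s).comp ?_
    exact measurable_fragLen.comp
      ((measurable_pastσ U (hI s hs)).prodMk measurable_const)
  · filter_upwards [hU.nested] with ω hω x _ y hy
    refine Finset.prod_congr rfl fun s hs => ?_
    rw [fragLen_eq_of_mem_of_subset (hω s r (hI s hs)) hy]

theorem tagIntegral_initial (hU : IsFragmentation q u U P) (g : Iic t → ℝ → ℝ≥0∞)
    (h : ℝ → ℝ≥0∞) :
    tagIntegral P u U ∅ g (zeroTime t) h =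
      ∑' J : u.fragments, ENNReal.ofReal J.1.length * h J.1.length := by
  have h1 : tagIntegral P u U ∅ g (zeroTime t) h =
      ∫⁻ _, (∫⁻ x in (u : Set ℝ), h (fragLen u x)) ∂P := by
    refine lintegral_congr_ae ?_
    filter_upwards [hU.initial] with ω hω
    simp [zeroTime, hω]
  rw [h1, lintegral_const, measure_univ, mul_one, setLIntegral_eq_tsum_fragments]
  refine tsum_congr fun J => ?_
  rw [setLIntegral_congr_fun J.1.isOpen.measurableSet
    (fun x hx => by rw [← length_fragment J hx]) (g := fun _ => h J.1.length),
    setLIntegral_const, volume_eq_ofReal_length, mul_comm]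

variable {P' : Measure Ω'} [IsProbabilityMeasure P'] {V : ℝ≥0 → Ω' → Config}

theorem tagIntegral_initial_unit (hV : IsFragmentation q unit V P') (g : Iic t → ℝ → ℝ≥0∞)
    (h : ℝ → ℝ≥0∞) : tagIntegral P' unit V ∅ g (zeroTime t) h = h 1 := by
  rw [hV.tagIntegral_initial]
  have h1 : unit ∈ unit.fragments := by simp [fragments_unit]
  rw [tsum_eq_single ⟨unit, h1⟩]
  · simp [length_unit]
  · rintro ⟨J, hJ⟩ hne
    refine absurd ?_ hne
    rw [fragments_unit] at hJ
    exact Subtype.ext hJ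

/-- The finite-dimensional laws of the tagged fragment length started from `u` are mixtures of
rescalings of those started from `(0,1)`. -/
theorem tagIntegral_eq_tsum (hU : IsFragmentation q u U P) (hV : IsFragmentation q unit V P')
    (I : Finset (Iic t)) : ∀ m : Iic t, (∀ s ∈ I, s ≤ m) → ∀ g : Iic t → ℝ → ℝ≥0∞,
    (∀ s, Measurable (g s)) → ∀ h : ℝ → ℝ≥0∞, Measurable h →
    tagIntegral P u U I g m h = ∑' J : u.fragments, ENNReal.ofReal J.1.length *
      tagIntegral P' unit V I (fun s l => g s (J.1.length * l)) m
        (fun l => h (J.1.length * l)) := by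
  -- Moves the final time from `r` to `m` by one transition on both sides.
  have extend : ∀ (I : Finset (Iic t)) (r : Iic t), (∀ s ∈ I, s ≤ r) →
      ∀ g : Iic t → ℝ → ℝ≥0∞, (∀ s, Measurable (g s)) →
      (∀ h : ℝ → ℝ≥0∞, Measurable h → tagIntegral P u U I g r h =
        ∑' J : u.fragments, ENNReal.ofReal J.1.length *
          tagIntegral P' unit V I (fun s l => g s (J.1.length * l)) r
            (fun l => h (J.1.length * l))) →
      ∀ m, r ≤ m → ∀ h : ℝ → ℝ≥0∞, Measurable h → tagIntegral P u U I g m h =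
        ∑' J : u.fragments, ENNReal.ofReal J.1.length *
          tagIntegral P' unit V I (fun s l => g s (J.1.length * l)) m
            (fun l => h (J.1.length * l)) := by
    intro I r hI g hg ih m hrm h hh
    rcases hrm.eq_or_lt with rfl | hlt
    · exact ih h hh
    · rw [hU.tagIntegral_step hI hlt hg hh, ih _ (measurable_tagOp _ hh)]
      refine tsum_congr fun J => ?_
      rw [hV.tagIntegral_step (g := fun s l => g s (J.1.length * l))
        (h := fun l => h (J.1.length * l)) hI hlt
        (fun s => (hg s).comp (measurable_const_mul _)) (hh.comp (measurable_const_mul _))]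
      simp only [tagOp_comp_mul]
  induction I using Finset.induction_on_max with
  | empty =>
    intro m _ g hg h hh
    refine extend ∅ (zeroTime t) (by simp) g hg (fun h hh => ?_) m (zero_le (a := m.1)) h hh
    rw [hU.tagIntegral_initial]
    simp only [hV.tagIntegral_initial_unit, mul_one]
  | insert a s has ih =>
    intro m hm g hg h hh
    refine extend (insert a s) a ?_ g hg (fun h hh => ?_) m
      (hm a (Finset.mem_insert_self a s)) h hh
    · intro b hb
      rcases Finset.mem_insert.1 hb with rfl | hb
      · exact le_rfl
      · exact (has b hb).le
    · have hnot : a ∉ s := fun ha => lt_irrefl _ (has a ha)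
      rw [tagIntegral_insert _ _ _ hnot,
        ih a (fun b hb => (has b hb).le) g hg (fun l => g a l * h l) ((hg a).mul hh)]
      simp only [tagIntegral_insert _ _ _ hnot]

/-- The path of the length of the fragment containing `x`, up to time `t`. -/
def _root_.Fragmentation.lengthPath (U : ℝ≥0 → Ω → Config) (t : ℝ≥0) (ω : Ω) (x : ℝ) :
    Iic t → ℝ := fun s => fragLen (U s ω) x

theorem _root_.Fragmentation.measurable_lengthPath (hU : ∀ s, Measurable (U s)) (t : ℝ≥0) :
    Measurable fun z : Ω × ℝ => lengthPath U t z.1 z.2 :=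
  measurable_pi_iff.2 fun s => measurable_fragLen_process hU s

instance isFiniteMeasure_restrict (w : Config) :
    IsFiniteMeasure (volume.restrict (w : Set ℝ)) :=
  ⟨by simpa [lt_top_iff_ne_top] using volume_ne_top w⟩

/-- The law of the tagged fragment length started from `u` is a mixture of rescalings of the law
started from `(0,1)`. -/
theorem lintegral_lengthPath (hU : IsFragmentation q u U P) (hV : IsFragmentation q unit V P')
    {Ψ : (Iic t → ℝ) → ℝ≥0∞} (hΨ : Measurable Ψ) :
    ∫⁻ ω, (∫⁻ x in (u : Set ℝ), Ψ (lengthPath U t ω x)) ∂P =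
      ∑' J : u.fragments, ENNReal.ofReal J.1.length *
        ∫⁻ ω, (∫⁻ x in (unit : Set ℝ), Ψ (J.1.length • lengthPath V t ω x)) ∂P' := by
  set μ : Measure (Iic t → ℝ) :=
    (P.prod (volume.restrict (u : Set ℝ))).map fun z => lengthPath U t z.1 z.2
  set ν : Measure (Iic t → ℝ) := Measure.sum fun J : u.fragments =>
    ENNReal.ofReal J.1.length • (P'.prod (volume.restrict (unit : Set ℝ))).map
      fun z => J.1.length • lengthPath V t z.1 z.2
  have hmU := measurable_lengthPath hU.measurable t
  have hmV := measurable_lengthPath hV.measurable t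
  have hμ : ∀ Ψ : (Iic t → ℝ) → ℝ≥0∞, Measurable Ψ → ∫⁻ y, Ψ y ∂μ =
      ∫⁻ ω, (∫⁻ x in (u : Set ℝ), Ψ (lengthPath U t ω x)) ∂P := by
    intro Ψ hΨ
    rw [lintegral_map hΨ hmU]
    exact lintegral_prod _ (hΨ.comp hmU).aemeasurable
  have hν : ∀ Ψ : (Iic t → ℝ) → ℝ≥0∞, Measurable Ψ → ∫⁻ y, Ψ y ∂ν =
      ∑' J : u.fragments, ENNReal.ofReal J.1.length *
        ∫⁻ ω, (∫⁻ x in (unit : Set ℝ), Ψ (J.1.length • lengthPath V t ω x)) ∂P' := by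
    intro Ψ hΨ
    rw [lintegral_sum_measure]
    refine tsum_congr fun J => ?_
    have hmJ : Measurable fun z : Ω' × ℝ => J.1.length • lengthPath V t z.1 z.2 :=
      measurable_pi_iff.2 fun s => (measurable_pi_iff.1 hmV s).const_mul _
    rw [lintegral_smul_measure, smul_eq_mul]
    congr 1
    rw [lintegral_map hΨ hmJ]
    exact lintegral_prod _ (hΨ.comp hmJ).aemeasurable
  -- The indicator of a cylinder is a product of one-time indicators, so `tagIntegral_eq_tsum` with
  -- `h = 1` applies. Cylinders form a generating π-system and `μ` is finite.
  have hcyl : ∀ S ∈ squareCylinders (fun _ : Iic t => {s : Set ℝ | MeasurableSet s}),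
      μ S = ν S := by
    rintro S ⟨I, B, hB, rfl⟩
    have hB' : ∀ s, MeasurableSet (B s) := fun s => hB s (mem_univ s)
    have hS : MeasurableSet ((I : Set (Iic t)).pi B) :=
      MeasurableSet.pi I.countable_toSet fun s _ => hB' s
    have hind : ∀ y : Iic t → ℝ, ((I : Set (Iic t)).pi B).indicator (1 : (Iic t → ℝ) → ℝ≥0∞) y =
        (∏ s ∈ I, (B s).indicator (fun _ => (1 : ℝ≥0∞)) (y s)) * 1 := by
      intro y
      rw [mul_one]
      by_cases hy : y ∈ (I : Set (Iic t)).pi B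
      · rw [indicator_of_mem hy, Pi.one_apply, Finset.prod_eq_one fun s hs => indicator_of_mem (hy s hs) _]
      · rw [indicator_of_notMem hy]
        simp only [Set.mem_pi, not_forall] at hy
        obtain ⟨s, hs, hys⟩ := hy
        exact (Finset.prod_eq_zero hs (indicator_of_notMem hys _)).symm
    rw [← lintegral_indicator_one hS, ← lintegral_indicator_one hS,
      hμ _ (measurable_one.indicator hS), hν _ (measurable_one.indicator hS)]
    have hfd := hU.tagIntegral_eq_tsum hV I ⟨t, mem_Iic.2 le_rfl⟩ (fun s _ => s.2)
      (fun s => (B s).indicator fun _ => (1 : ℝ≥0∞))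
      (fun s => measurable_const.indicator (hB' s)) (fun _ => 1) measurable_const
    simp only [tagIntegral] at hfd
    simp only [hind]
    exact hfd
  have : IsFiniteMeasure μ := Measure.isFiniteMeasure_map _ _
  have huniv : (univ : Set (Iic t → ℝ)) ∈
      squareCylinders (fun _ : Iic t => {s : Set ℝ | MeasurableSet s}) :=
    ⟨∅, fun _ => univ, fun _ _ => mem_ofPred_eq ▸ MeasurableSet.univ, by simp⟩
  have heq : μ = ν := ext_of_generate_finite _ generateFrom_squareCylinders.symm
    (isPiSystem_squareCylinders (fun _ => MeasurableSpace.isPiSystem_measurableSet) (by simp))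
    hcyl (hcyl _ huniv)
  rw [← hμ Ψ hΨ, heq, hν Ψ hΨ]

end IsFragmentation

end Fragmentation

end

/-! ### The uniform tag and the change of measure -/

noncomputable section

namespace Fragmentation

open Config

variable {Ω : Type*} [MeasurableSpace Ω]

/-- The functional of length paths corresponding to the functional `F` of the paths of `ζ`,
biased by the inverse of the final length. -/
def pathWeight (c : ℝ) (t : ℝ≥0) (F : (Iic t → ℝ) → ℝ≥0∞) (l : Iic t → ℝ) : ℝ≥0∞ :=
  ENNReal.ofReal (l ⟨t, mem_Iic.2 le_rfl⟩)⁻¹ * F fun s => -Real.log (l s) - c * (s : ℝ≥0)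

theorem measurable_pathWeight (c : ℝ) (t : ℝ≥0) {F : (Iic t → ℝ) → ℝ≥0∞} (hF : Measurable F) :
    Measurable (pathWeight c t F) := by
  refine Measurable.mul (measurable_pi_apply _).inv.ennreal_ofReal (hF.comp ?_)
  exact measurable_pi_iff.2 fun s => (measurable_pi_apply s).log.neg.sub_const _

theorem IsFragmentation.lintegral_fragmentSum {q : ℝ≥0 → ProbabilityMeasure Config} {u : Config}
    {U : ℝ≥0 → Ω → Config} {P : Measure Ω} (hU : IsFragmentation q u U P) (c : ℝ) (t : ℝ≥0)
    (F : (Iic t → ℝ) → ℝ≥0∞) :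
    ∫⁻ ω, fragmentSum (U t ω) (fun x => F fun s => zeta c U x s ω) ∂P =
      ∫⁻ ω, (∫⁻ x in (u : Set ℝ), pathWeight c t F (lengthPath U t ω x)) ∂P := by
  refine lintegral_congr_ae ?_
  filter_upwards [hU.nested, hU.ae_setLIntegral_eq] with ω hn hω
  rw [fragmentSum_eq_lintegral, hω t]
  · rfl
  · intro x _ y hy
    congr 1
    funext s
    have h := fragLen_eq_of_mem_of_subset (hn s t s.2) hy
    simp only [fragLen] at h
    simp only [zeta, xi, h]

section Tag

variable {q : ℝ≥0 → ProbabilityMeasure Config} {V : ℝ≥0 → Ω → Config} {P : Measure Ω}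
  [IsProbabilityMeasure P] {υ : Ω → ℝ}

/-- Integration over an independent uniform tag. -/
theorem IsUniformTag.lintegral_lengthPath (hυ : IsUniformTag υ V P)
    (hV : ∀ t, Measurable (V t)) {t : ℝ≥0} {Ψ : (Iic t → ℝ) → ℝ≥0∞} (hΨ : Measurable Ψ) :
    ∫⁻ ω, Ψ (lengthPath V t ω (υ ω)) ∂P =
      ∫⁻ ω, (∫⁻ x in (unit : Set ℝ), Ψ (lengthPath V t ω x)) ∂P := by
  have hVm : Measurable fun ω t => V t ω := measurable_pi_iff.2 hV
  have hprod := (indepFun_iff_map_prod_eq_prod_map_map hυ.measurable.aemeasurable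
    hVm.aemeasurable).1 hυ.indep
  rw [hυ.uniform] at hprod
  set W : ℝ≥0 → (ℝ≥0 → Config) → Config := fun s v => v s
  have hW : ∀ s, Measurable (W s) := fun s => measurable_pi_apply s
  have hk : Measurable fun z : ℝ × (ℝ≥0 → Config) => Ψ (lengthPath W t z.2 z.1) :=
    (hΨ.comp (measurable_lengthPath hW t)).comp measurable_swap
  have h1 : ∫⁻ ω, Ψ (lengthPath V t ω (υ ω)) ∂P =
      ∫⁻ z, Ψ (lengthPath W t z.2 z.1) ∂(P.map fun ω => (υ ω, fun t => V t ω)) :=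
    (lintegral_map hk (hυ.measurable.prodMk hVm)).symm
  have hk' : Measurable fun v : ℝ≥0 → Config =>
      ∫⁻ x in Ioo (0 : ℝ) 1, Ψ (lengthPath W t v x) :=
    (hΨ.comp (measurable_lengthPath hW t)).lintegral_prod_right'
  rw [h1, hprod, lintegral_prod_symm _ hk.aemeasurable, lintegral_map hk' hVm]
  rfl

/-- `V t` has full measure in `(0,1)`, so the tag a.s. lies in it; nestedness covers all earlier
times at once. Positivity is what allows `log (a * l)` to be split. -/
theorem IsUniformTag.ae_fragLen_pos (hυ : IsUniformTag υ V P) (hV : IsFragmentation q unit V P)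
    (t : ℝ≥0) : ∀ᵐ ω ∂P, ∀ s ≤ t, 0 < fragLen (V s ω) (υ ω) := by
  set S : Set (Iic t → ℝ) := {l | l ⟨t, mem_Iic.2 le_rfl⟩ ≤ 0}
  have hS : MeasurableSet S := measurableSet_le (measurable_pi_apply _) measurable_const
  have hΨ : Measurable (S.indicator (1 : (Iic t → ℝ) → ℝ≥0∞)) := measurable_one.indicator hS
  have h0 : ∫⁻ ω, S.indicator (1 : (Iic t → ℝ) → ℝ≥0∞) (lengthPath V t ω (υ ω)) ∂P = 0 := by
    rw [hυ.lintegral_lengthPath hV.measurable hΨ]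
    refine (lintegral_congr_ae (g := fun _ => 0) ?_).trans lintegral_zero
    filter_upwards [hV.ae_setLIntegral_eq] with ω hω
    rw [hω t]
    refine (setLIntegral_congr_fun (g := fun _ => 0) (V t ω).isOpen.measurableSet
      fun x hx => ?_).trans lintegral_zero
    have hmem : lengthPath V t ω x ∉ S := fun h => (fragLen_pos hx).not_ge h
    simp only [indicator_of_notMem hmem]
  have hm : Measurable fun ω => S.indicator (1 : (Iic t → ℝ) → ℝ≥0∞)
      (lengthPath V t ω (υ ω)) :=
    hΨ.comp ((measurable_lengthPath hV.measurable t).comp (measurable_id.prodMk hυ.measurable))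
  rw [lintegral_eq_zero_iff hm] at h0
  filter_upwards [h0, hV.nested] with ω hω hn s hs
  have ht : 0 < fragLen (V t ω) (υ ω) := by
    by_contra hle
    have hmem : lengthPath V t ω (υ ω) ∈ S := not_lt.1 hle
    simp [indicator_of_mem hmem] at hω
  exact ht.trans_le (fragLen_mono (hn s t hs) _)

omit [IsProbabilityMeasure P] in
theorem IsTilted.lintegral_eq {Q : Measure Ω} {p : ℝ} {t : ℝ≥0} (hQ : IsTilted P Q V υ p t)
    (hV : ∀ t, Measurable (V t)) (hυ : Measurable υ) {G : Ω → ℝ≥0∞}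
    (hG : Measurable[taggedPastσ V υ t] G) :
    ∫⁻ ω, G ω ∂Q = ∫⁻ ω, ENNReal.ofReal (expMart P V υ p t ω) * G ω ∂P := by
  have hle : taggedPastσ V υ t ≤ ‹MeasurableSpace Ω› :=
    sup_le hυ.comap_le (pastσ_le hV t)
  have hd : Measurable fun ω => ENNReal.ofReal (expMart P V υ p t ω) := by
    have hx : Measurable fun ω => taggedXi V υ t ω :=
      ((measurable_fragLen.comp ((hV t).prodMk hυ)).log).neg
    exact ((hx.const_mul p).const_sub _).exp.ennreal_ofReal
  have h1 : Q.trim hle =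
      (P.withDensity fun ω => ENNReal.ofReal (expMart P V υ p t ω)).trim hle := by
    refine @Measure.ext _ (taggedPastσ V υ t) _ _ fun B hB => ?_
    rw [trim_measurableSet_eq hle hB, trim_measurableSet_eq hle hB,
      withDensity_apply _ (hle B hB), hQ B hB]
  rw [← lintegral_trim hle hG, h1, lintegral_trim hle hG,
    lintegral_withDensity_eq_lintegral_mul _ hd (hG.mono hle le_rfl)]
  rfl

omit [MeasurableSpace Ω] in
theorem measurable_taggedXi (V : ℝ≥0 → Ω → Config) (υ : Ω → ℝ) {s t : ℝ≥0} (hst : s ≤ t) :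
    Measurable[taggedPastσ V υ t] (taggedXi V υ s) := by
  have h1 : Measurable[taggedPastσ V υ t] (V s) :=
    (measurable_pastσ V hst).mono le_sup_right le_rfl
  have h2 : Measurable[taggedPastσ V υ t] υ :=
    measurable_iff_comap_le.2 le_sup_left
  exact Measurable.neg (Measurable.log (measurable_fragLen.comp (h1.prodMk h2)))

omit [IsProbabilityMeasure P] in
theorem IsPBar.Phi_eq [IsProbabilityMeasure P] {p : ℝ} (hp : IsPBar P V υ p) :
    Phi P V υ p = (1 + p) * deriv (Phi P V υ) p := by
  have h1 : -1 ≤ pLower P V υ := by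
    -- The exponent `0` is always integrable, so the set is nonempty and its infimum is not a
    -- default value.
    refine le_csInf ⟨0, by norm_num, ?_⟩ fun p hp => hp.1
    simp
  have h2 : 1 + p ≠ 0 := by linarith [hp.1]
  rw [← hp.2, mul_div_cancel₀ _ h2]

/-- The tagged form of the many-to-one formula, for lengths rescaled by `a`. -/
theorem IsTilted.lintegral_pathWeight {Q : Measure Ω} {p c a : ℝ} {t : ℝ≥0}
    (hQ : IsTilted P Q V υ p t) (hV : IsFragmentation q unit V P) (hυ : IsUniformTag υ V P)
    (hp : IsPBar P V υ p) (hc : c = deriv (Phi P V υ) p) (ha : 0 < a)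
    {F : (Iic t → ℝ) → ℝ≥0∞} (hF : Measurable F) :
    ENNReal.ofReal a *
        ∫⁻ ω, (∫⁻ x in (unit : Set ℝ), pathWeight c t F (a • lengthPath V t ω x)) ∂P =
      ∫⁻ ω, ENNReal.ofReal (Real.exp (taggedZeta c V υ t ω * (p + 1))) *
        F (fun s => taggedZeta c V υ s ω - Real.log a) ∂Q := by
  have hscale : Measurable fun l : Iic t → ℝ => a • l :=
    measurable_id.const_smul a
  have hΨ : Measurable fun l : Iic t → ℝ => pathWeight c t F (a • l) :=
    (measurable_pathWeight c t hF).comp hscale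
  have hζ : ∀ s ≤ t, Measurable[taggedPastσ V υ t] (taggedZeta c V υ s) := fun s hs =>
    (measurable_taggedXi V υ hs).sub_const _
  have hG : Measurable[taggedPastσ V υ t] fun ω =>
      ENNReal.ofReal (Real.exp (taggedZeta c V υ t ω * (p + 1))) *
        F (fun s => taggedZeta c V υ s ω - Real.log a) := by
    refine Measurable.mul ((hζ t le_rfl).mul_const _).exp.ennreal_ofReal (hF.comp ?_)
    exact @measurable_pi_lambda _ _ _ (taggedPastσ V υ t) _ _
      fun s => (hζ s s.2).sub_const _
  have hm : Measurable fun ω => pathWeight c t F (a • lengthPath V t ω (υ ω)) :=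
    hΨ.comp ((measurable_lengthPath hV.measurable t).comp (measurable_id.prodMk hυ.measurable))
  rw [hQ.lintegral_eq hV.measurable hυ.measurable hG,
    ← hυ.lintegral_lengthPath hV.measurable hΨ, ← lintegral_const_mul _ hm]
  refine lintegral_congr_ae ?_
  filter_upwards [hυ.ae_fragLen_pos hV t] with ω hω
  have hpath : (fun s : Iic t => -Real.log ((a • lengthPath V t ω (υ ω)) s) - c * (s : ℝ≥0)) =
      fun s : Iic t => taggedZeta c V υ s ω - Real.log a := by
    funext s
    have hl : lengthPath V t ω (υ ω) s = fragLen (V s ω) (υ ω) := rfl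
    rw [Pi.smul_apply, smul_eq_mul, hl, Real.log_mul ha.ne' (hω s s.2).ne']
    simp only [taggedZeta, zeta, xi, fragLen]
    ring
  have hL := hω t le_rfl
  -- The mixture weight `a` cancels the `a` in the inverse length; what remains is `exp(ξ_t)`,
  -- because `(1 + p) c t - p ξ_t + (p + 1)(ξ_t - c t) = ξ_t`.
  have hweight : ENNReal.ofReal a * ENNReal.ofReal (a * fragLen (V t ω) (υ ω))⁻¹ =
      ENNReal.ofReal (expMart P V υ p t ω) *
        ENNReal.ofReal (Real.exp (taggedZeta c V υ t ω * (p + 1))) := by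
    rw [expMart, ← ENNReal.ofReal_mul ha.le, ← ENNReal.ofReal_mul (Real.exp_pos _).le,
      ← Real.exp_add, hp.Phi_eq, ← hc]
    congr 1
    have hxi : taggedXi V υ t ω = -Real.log (fragLen (V t ω) (υ ω)) := rfl
    have hexp : (1 + p) * c * t - p * taggedXi V υ t ω + taggedZeta c V υ t ω * (p + 1) =
        taggedXi V υ t ω := by
      simp only [taggedZeta, taggedXi, zeta]
      ring
    rw [hexp, hxi, Real.exp_neg, Real.exp_log hL]
    field_simp
  rw [← mul_assoc, ← hweight, mul_assoc, ← hpath]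
  rfl

end Tag

end Fragmentation

end

/-- Many-to-one formula. `U` is a fragmentation started from `u`, `V` one with the same transition
data started from `(0,1)`, and `υ` an independent uniform tag for `V`. The path space is
`ℝ^[0,t]` with the σ-algebra generated by the coordinates; a measurable functional on a smaller
path space (such as the càdlàg paths), with the trace σ-algebra, is the restriction of a measurable
one on `ℝ^[0,t]`. `Q` is any measure with density `ℰ_p(t)` with respect to `P` on the past of time
`t`, in particular one that has this property at all times. -/
theorem mainTheorem2 {Ω Ω' : Type*} [MeasurableSpace Ω] [MeasurableSpace Ω']
    (q : ℝ≥0 → ProbabilityMeasure Fragmentation.Config)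
    (u : Fragmentation.Config) (Pu : Measure Ω) [IsProbabilityMeasure Pu]
    (U : ℝ≥0 → Ω → Fragmentation.Config) (hU : Fragmentation.IsFragmentation q u U Pu)
    (P : Measure Ω') [IsProbabilityMeasure P]
    (V : ℝ≥0 → Ω' → Fragmentation.Config)
    (hV : Fragmentation.IsFragmentation q Fragmentation.Config.unit V P)
    (υ : Ω' → ℝ) (hυ : Fragmentation.IsUniformTag υ V P)
    (p c : ℝ) (hp : Fragmentation.IsPBar P V υ p) (hc : c = deriv (Fragmentation.Phi P V υ) p)
    (t : ℝ≥0) (Q : Measure Ω') (hQ : Fragmentation.IsTilted P Q V υ p t)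
    (F : (Set.Iic t → ℝ) → ℝ≥0∞) (hF : Measurable F) :
    (∫⁻ ω, Fragmentation.fragmentSum (U t ω)
          (fun x => F fun s => Fragmentation.zeta c U x s ω) ∂Pu =
        ∑' J : u.fragments,
          ∫⁻ ω, ENNReal.ofReal (Real.exp (Fragmentation.taggedZeta c V υ t ω * (p + 1))) *
            F (fun s => Fragmentation.taggedZeta c V υ s ω - Real.log J.1.length) ∂Q) ∧
      ∫⁻ ω, Fragmentation.fragmentSum (V t ω)
          (fun x => F fun s => Fragmentation.zeta c V x s ω) ∂P =
        ∫⁻ ω, ENNReal.ofReal (Real.exp (Fragmentation.taggedZeta c V υ t ω * (p + 1))) *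
          F (fun s => Fragmentation.taggedZeta c V υ s ω) ∂Q := by
  have hu := hU.lintegral_lengthPath hV (Fragmentation.measurable_pathWeight c t hF)
  -- For `(0,1)` the scale is `a = 1`, so the shift `log a` vanishes.
  have hv := hQ.lintegral_pathWeight hV hυ hp hc one_pos hF
  refine ⟨?_, ?_⟩
  · rw [hU.lintegral_fragmentSum, hu]
    exact tsum_congr fun J =>
      hQ.lintegral_pathWeight hV hυ hp hc (Fragmentation.Config.length_fragment_pos J) hF
  · rw [hV.lintegral_fragmentSum]
    simpa using hv
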